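/- Let $\mathbb{F}_q$ be a finite field with $q$ elements, let $0<k<n\le q$ and $0<b\le (k+1)/2$ be integers, and let $C=RS_k(n,b)$ be a Reed--Solomon code over $\mathbb{F}_q$, i.e. the cyclic code of length $n$ with generator polynomial $(x-\alpha^b)(x-\alpha^{b+1})\cdots(x-\alpha^{b+n-k-1})$, where $\alpha\in\mathbb{F}_q$ has multiplicative order $n$ (a primitive element of $\mathbb{F}_q$ when $n=q-1$). Assume that $n+2b-2k-1\ge 0$. Then there is an MDS QUENTA code with parameters $$[[n,\;2b-1,\;n-k+1;\;n+2b-2k-1]]_q .$$ If $b=(k+1)/2$ (in which case $n+2b-2k-1=n-k\geq 0$ automatically), this code has maximal entanglement. Here an $[[n,K,d;c]]_q$ QUENTA (entanglement-assisted quantum) code, $K\ge 1$, encodes $K$ logical qudits of dimension $q$ into $n$ qudits of dimension $q$ with the help of $c$ maximally entangled pairs of qudits shared by sender and receiver: the sender applies an isometry to the logical qudits and to its halves of the pairs, and the receiver's halves are error-free. Its minimum distance is $d$: the code (a subspace of the joint space of the $n$ sent qudits and the receiver's $c$ qudits) detects every error acting on fewer than $d$ of the $n$ sent qudits, but not every error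 acting on $d$ of them. The code is MDS if it attains the quantum Singleton bound, $2(d-1)=n-K+c$, and has maximal entanglement if $c=n-K$. -/

import Mathlib

noncomputable section

/-! ### Reed-Solomon codes as cyclic codes -/

/-- The polynomial `v₀ + v₁ X + ⋯ + vₙ₋₁ X ^ (n-1)` attached to a word `v` of length `n`. -/
def wordPoly (F : Type*) [Field F] (n : ℕ) : (Fin n → F) →ₗ[F] Polynomial F :=
  ∑ i : Fin n, (Polynomial.monomial (i : ℕ)).comp (LinearMap.proj i)

/-- The cyclic code of length `n` with generator polynomial `g` (a divisor of `X ^ n - 1`):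
all words whose polynomial is a multiple of `g`. -/
def cyclicCode {F : Type*} [Field F] (n : ℕ) (g : Polynomial F) : Submodule F (Fin n → F) :=
  ((Ideal.span {g}).restrictScalars F).comap (wordPoly F n)

/-- `C = RS_k(n, b)`: the cyclic code of length `n` with generator polynomial
`(X - α ^ b) (X - α ^ (b + 1)) ⋯ (X - α ^ (b + n - k - 1))`, for some element `α` of
multiplicative order `n` in the field (a primitive element of the field when `n = q - 1`). -/
def IsReedSolomonCode {F : Type*} [Field F] {n : ℕ} (k b : ℕ)
    (C : Submodule F (Fin n → F)) : Prop :=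
  ∃ α : F, IsPrimitiveRoot α n ∧
    C = cyclicCode n
      (∏ j ∈ Finset.range (n - k), (Polynomial.X - Polynomial.C (α ^ (b + j))))

/-! ### Entanglement-assisted quantum (QUENTA) codes

A qudit has the orthonormal basis `|x⟩`, `x : D`, so that the local dimension is `q = |D|`. -/

/-- The state space of `n` qudits. -/
abbrev Qudits (D : Type*) [Fintype D] (n : ℕ) : Type _ :=
  EuclideanSpace ℂ (Fin n → D)

/-- The state space of two registers of `n` and `m` qudits, `Qudits D n ⊗ Qudits D m`. -/
abbrev QuditPair (D : Type*) [Fintype D] (n m : ℕ) : Type _ :=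
  EuclideanSpace ℂ ((Fin n → D) × (Fin m → D))

/-- `c` maximally entangled pairs `q ^ (-1/2) ∑ x, |x⟩|x⟩`, with the `c` halves of the sender
collected in the first register and those of the receiver in the second one. -/
def ebits (D : Type*) [Fintype D] [DecidableEq D] (c : ℕ) : QuditPair D c c :=
  WithLp.toLp 2 fun p =>
    if p.1 = p.2 then (((Real.sqrt (Fintype.card D))⁻¹ ^ c : ℝ) : ℂ) else 0

/-- Encoding of `K` logical qudits `φ` with `c` ebits: the sender applies an isometry `V` (a
unitary acting on its registers and on ancillas in a fixed state) to the logical register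
and its halves of the ebits, the halves of the receiver are left alone:
`φ ↦ (V ⊗ 1) (φ ⊗ ebits)`. -/
def encode {D : Type*} [Fintype D] [DecidableEq D] {n K c : ℕ}
    (V : QuditPair D K c →ₗᵢ[ℂ] Qudits D n) : Qudits D K →ₗ[ℂ] QuditPair D n c where
  toFun φ := WithLp.toLp 2 fun p =>
    V (WithLp.toLp 2 fun xy => φ xy.1 * ebits D c (xy.2, p.2)) p.1
  map_add' φ φ' := by
    ext p
    simp only [PiLp.add_apply, add_mul]
    rw [← PiLp.add_apply, ← map_add]
    rfl
  map_smul' r φ := by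
    ext p
    simp only [PiLp.smul_apply, smul_eq_mul, mul_assoc, RingHom.id_apply]
    rw [← smul_eq_mul, ← PiLp.smul_apply, ← map_smul]
    rfl

/-- The operator `E` on `n` qudits acts only on the qudits in `T`: it is of the form `M ⊗ 1`,
with `M` on the qudits in `T` and the identity on the others. -/
def ActsOnlyOn {D : Type*} [DecidableEq D] {n : ℕ} (T : Finset (Fin n))
    (E : Matrix (Fin n → D) (Fin n → D) ℂ) : Prop :=
  ∃ M : Matrix (T → D) (T → D) ℂ, ∀ a a' : Fin n → D,
    E a a' = if ∀ i, i ∉ T → a i = a' i then M (fun i => a i) (fun i => a' i) else 0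

/-- The action of `E ⊗ 1`: the error `E` hits the `n` transmitted qudits only. -/
def applyError {D : Type*} [Fintype D] {n c : ℕ} (E : Matrix (Fin n → D) (Fin n → D) ℂ)
    (ψ : QuditPair D n c) : QuditPair D n c :=
  WithLp.toLp 2 fun p => ∑ a', E p.1 a' * ψ (a', p.2)

/-- The code `Q` detects the error `E` (Knill-Laflamme condition `P E P = t P`, where `P` is the
orthogonal projection onto `Q`). -/
def Detects {D : Type*} [Fintype D] {n c : ℕ} (Q : Submodule ℂ (QuditPair D n c))
    (E : Matrix (Fin n → D) (Fin n → D) ℂ) : Prop :=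
  ∃ t : ℂ, ∀ u ∈ Q, ∀ v ∈ Q, inner ℂ u (applyError E v) = t * inner ℂ u v

/-- `Q` is an `[[n, K, d; c]]_q` QUENTA code, `q = |D|`, `K ≥ 1`: it encodes `K` qudits into `n`
qudits with the help of `c` ebits, and its minimum distance is exactly `d`, that is, it detects
all errors on fewer than `d` of the `n` transmitted qudits (so that it corrects
`⌊(d - 1) / 2⌋` errors), but not all errors on `d` of them. -/
structure IsQUENTACode {D : Type*} [Fintype D] [DecidableEq D] (n K d c : ℕ)
    (Q : Submodule ℂ (QuditPair D n c)) : Prop where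
  exists_encoder : ∃ V : QuditPair D K c →ₗᵢ[ℂ] Qudits D n, Q = LinearMap.range (encode V)
  detects : ∀ T : Finset (Fin n), T.card < d →
    ∀ E : Matrix (Fin n → D) (Fin n → D) ℂ, ActsOnlyOn T E → Detects Q E
  not_detects : ∃ T : Finset (Fin n), T.card = d ∧
    ∃ E : Matrix (Fin n → D) (Fin n → D) ℂ, ActsOnlyOn T E ∧ ¬ Detects Q E

/-- The parameters attain the quantum Singleton bound `2 (d - 1) ≤ n - K + c`. -/
def IsMDSParameters (n K d c : ℕ) : Prop :=
  2 * ((d : ℤ) - 1) = (n : ℤ) - K + c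

/-- Maximal entanglement: `c = n - K`. -/
def IsMaximalEntanglement (n K c : ℕ) : Prop :=
  (c : ℤ) = (n : ℤ) - K

end

/-! Put `K = 2b - 1`, `s = k + 1 - 2b`, `c = n + 2b - 2k - 1`, so that `K + s = k`, `s + c = n - k`
and `n = K + 2s + c`. The logical word `x`, a uniformly superposed word `z` and the ebit word `y`
are the low, middle and top coefficient blocks of a polynomial of degree below `K + s + c ≤ n`, and
the sender transmits its values at the points `1, α, ..., α ^ (n-1)`. The receiver keeps `y`.

Detection on `T` splits into two conditions (`detects_of_actsOnlyOn`). Distinct words with the same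
`y` must differ off `T`: their difference has degree below `k`, hence fewer than `k` zeros. The
restriction to `T` must not reveal `x`: the blocks `z, y` interpolate any values on up to `n - k`
nonzero points. Both hold for `|T| ≤ n - k`. For `|T| = n - k + 1`, a polynomial of degree `k - 1`
vanishing exactly at the points off `T` gives a logical shift (`exists_not_detects`). -/

open Polynomial

/-! ### Encoders from additive maps -/

section Encoder

variable {D : Type*} [Fintype D] [DecidableEq D] [AddCommGroup D] {n K c : ℕ}
  {Z : Type*} [Fintype Z] [DecidableEq Z] [AddCommGroup Z]

/-- The linear map `|x⟩|y⟩ ↦ |Z| ^ (-1/2) ∑ z, |f (x, y, z)⟩`. -/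
noncomputable def cosetMap (f : (Fin K → D) × (Fin c → D) × Z →+ (Fin n → D)) :
    QuditPair D K c →ₗ[ℂ] Qudits D n where
  toFun ψ := WithLp.toLp 2 fun a =>
    (((Real.sqrt (Fintype.card Z))⁻¹ : ℝ) : ℂ) *
      ∑ i, if f i = a then ψ (i.1, i.2.1) else 0
  map_add' ψ ψ' := by
    ext a
    simp only [PiLp.add_apply, ← mul_add, ← Finset.sum_add_distrib]
    congr 2
    ext i
    split_ifs <;> simp
  map_smul' r ψ := by
    ext a
    simp only [PiLp.smul_apply, smul_eq_mul, RingHom.id_apply, mul_left_comm r, Finset.mul_sum,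
      mul_ite, mul_zero]

/-- A sesquilinear form evaluated at two push-forwards along `g`. -/
lemma sum_pushforward {ι κ : Type*} [Fintype ι] [Fintype κ] [DecidableEq κ] (g : ι → κ)
    (u v : ι → ℂ) (B : κ → κ → ℂ) :
    ∑ a, ∑ a', (∑ i, if g i = a then u i else 0) * (B a a' * ∑ j, if g j = a' then v j else 0) =
      ∑ i, ∑ j, u i * (B (g i) (g j) * v j) := by
  have h (a : κ) : ∑ a', B a a' * (∑ j, if g j = a' then v j else 0) =
      ∑ j, B a (g j) * v j := by
    simp only [Finset.mul_sum, mul_ite, mul_zero]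
    rw [Finset.sum_comm]
    simp
  simp only [← Finset.mul_sum, h]
  simp only [Finset.sum_mul, ite_mul, zero_mul]
  rw [Finset.sum_comm]
  simp

lemma sum_pushforward_inner {ι κ : Type*} [Fintype ι] [Fintype κ] [DecidableEq κ] (g : ι → κ)
    (u v : ι → ℂ) :
    ∑ a, (∑ i, if g i = a then u i else 0) * (∑ j, if g j = a then v j else 0) =
      ∑ i, ∑ j, if g i = g j then u i * v j else 0 := by
  have := sum_pushforward g u v (fun a a' => if a = a' then 1 else 0)
  simpa using this

lemma inv_sqrt_mul_self (m : ℕ) :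
    (((Real.sqrt m)⁻¹ : ℝ) : ℂ) * (((Real.sqrt m)⁻¹ : ℝ) : ℂ) = (m : ℂ)⁻¹ := by
  rw [← Complex.ofReal_mul, ← mul_inv, Real.mul_self_sqrt (Nat.cast_nonneg m)]
  simp

/-- Injectivity makes the basis words `|f (x, y, z)⟩` distinct, so only diagonal terms survive; the
`|Z|` choices of `z` cancel the normalization. -/
lemma cosetMap_inner (f : (Fin K → D) × (Fin c → D) × Z →+ (Fin n → D))
    (hf : Function.Injective f) (ψ ψ' : QuditPair D K c) :
    inner ℂ (cosetMap f ψ) (cosetMap f ψ') = inner ℂ ψ ψ' := by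
  have hZ : (Fintype.card Z : ℂ) ≠ 0 := by simp
  have key := sum_pushforward_inner f (fun i => starRingEnd ℂ (ψ (i.1, i.2.1)))
    (fun i => ψ' (i.1, i.2.1))
  simp only [hf.eq_iff, Finset.sum_ite_eq, Finset.mem_univ, if_true] at key
  simp only [PiLp.inner_apply, RCLike.inner_apply, cosetMap, LinearMap.coe_mk, AddHom.coe_mk,
    map_mul, Complex.conj_ofReal, map_sum, apply_ite (starRingEnd ℂ), map_zero]
  calc _ = (Fintype.card Z : ℂ)⁻¹ * ∑ a, (∑ i, if f i = a then
            starRingEnd ℂ (ψ (i.1, i.2.1)) else 0) *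
          (∑ j, if f j = a then ψ' (j.1, j.2.1) else 0) := by
        rw [← inv_sqrt_mul_self, Finset.mul_sum]
        refine Finset.sum_congr rfl fun a _ => ?_
        ring
    _ = _ := by
        rw [key]
        simp only [Fintype.sum_prod_type, Finset.sum_const, Finset.card_univ, nsmul_eq_mul,
          ← Finset.mul_sum]
        rw [inv_mul_cancel_left₀ hZ]
        simp only [mul_comm]

/-- The isometry `|x⟩|y⟩ ↦ |Z| ^ (-1/2) ∑ z, |f (x, y, z)⟩` for injective `f`. -/
noncomputable def cosetIsometry (f : (Fin K → D) × (Fin c → D) × Z →+ (Fin n → D))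
    (hf : Function.Injective f) : QuditPair D K c →ₗᵢ[ℂ] Qudits D n :=
  (cosetMap f).isometryOfInner (cosetMap_inner f hf)

/-- The normalization of the encoded states. -/
noncomputable def cosetNorm (D Z : Type*) [Fintype D] [Fintype Z] (c : ℕ) : ℝ :=
  (Real.sqrt (Fintype.card Z))⁻¹ * (Real.sqrt (Fintype.card D))⁻¹ ^ c

lemma encode_cosetIsometry_apply (f : (Fin K → D) × (Fin c → D) × Z →+ (Fin n → D))
    (hf : Function.Injective f) (φ : Qudits D K) (p : (Fin n → D) × (Fin c → D)) :
    encode (cosetIsometry f hf) φ p =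
      (cosetNorm D Z c : ℂ) * ∑ i, if (f i, i.2.1) = p then φ i.1 else 0 := by
  obtain ⟨a, y⟩ := p
  simp only [encode, cosetIsometry, LinearMap.coe_mk, AddHom.coe_mk,
    LinearMap.coe_isometryOfInner, cosetMap, ebits, cosetNorm, Complex.ofReal_mul, mul_assoc,
    Finset.mul_sum]
  refine Finset.sum_congr rfl fun i _ => ?_
  by_cases h1 : f i = a <;> by_cases h2 : i.2.1 = y <;> simp [h1, h2, mul_comm]

/-- The error leaves the receiver's register, which stores `y`, untouched, so only terms with equal
`y` interfere. -/
lemma inner_encode_applyError (f : (Fin K → D) × (Fin c → D) × Z →+ (Fin n → D))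
    (hf : Function.Injective f) (φ φ' : Qudits D K) (E : Matrix (Fin n → D) (Fin n → D) ℂ) :
    inner ℂ (encode (cosetIsometry f hf) φ) (applyError E (encode (cosetIsometry f hf) φ')) =
      (cosetNorm D Z c : ℂ) ^ 2 * ∑ i, ∑ j, starRingEnd ℂ (φ i.1) *
        ((if i.2.1 = j.2.1 then E (f i) (f j) else 0) * φ' j.1) := by
  have key := sum_pushforward (fun i : (Fin K → D) × (Fin c → D) × Z => (f i, i.2.1))
    (fun i => starRingEnd ℂ (φ i.1)) (fun j => φ' j.1)
    (fun p p' => if p.2 = p'.2 then E p.1 p'.1 else 0)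
  rw [← key]
  simp only [PiLp.inner_apply, RCLike.inner_apply, applyError, encode_cosetIsometry_apply,
    map_mul, Complex.conj_ofReal, map_sum, apply_ite (starRingEnd ℂ), map_zero]
  rw [Finset.mul_sum]
  refine Finset.sum_congr rfl fun p _ => ?_
  have hprod (g : (Fin n → D) × (Fin c → D) → ℂ) : ∑ p', g p' = ∑ a', ∑ y, g (a', y) :=
    Fintype.sum_prod_type g
  rw [hprod]
  simp only [ite_mul, zero_mul, mul_ite, mul_zero, Finset.sum_ite_eq, Finset.mem_univ, if_true]
  simp only [← Finset.mul_sum, mul_left_comm _ (cosetNorm D Z c : ℂ)]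
  ring

/-- An operator without matrix elements between different words that share the receiver's
part acts on the code diagonally. -/
lemma inner_encode_applyError_of_diagonal
    (f : (Fin K → D) × (Fin c → D) × Z →+ (Fin n → D))
    (hf : Function.Injective f) (φ φ' : Qudits D K) (E : Matrix (Fin n → D) (Fin n → D) ℂ)
    (hE : ∀ i j, i.2.1 = j.2.1 → i ≠ j → E (f i) (f j) = 0) :
    inner ℂ (encode (cosetIsometry f hf) φ) (applyError E (encode (cosetIsometry f hf) φ')) =
      (cosetNorm D Z c : ℂ) ^ 2 * ∑ x, starRingEnd ℂ (φ x) * φ' x *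
        ∑ w : (Fin c → D) × Z, E (f (x, w)) (f (x, w)) := by
  rw [inner_encode_applyError]
  congr 1
  have h (i : (Fin K → D) × (Fin c → D) × Z) : ∑ j, starRingEnd ℂ (φ i.1) *
      ((if i.2.1 = j.2.1 then E (f i) (f j) else 0) * φ' j.1) =
      starRingEnd ℂ (φ i.1) * φ' i.1 * E (f i) (f i) := by
    rw [Finset.sum_eq_single i]
    · rw [if_pos rfl]; ring
    · intro j _ hj
      split_ifs with h
      · rw [hE i j h hj.symm]; ring
      · ring
    · simp
  simp only [h, Finset.mul_sum]
  rw [Fintype.sum_prod_type]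

lemma applyError_one {D : Type*} [Fintype D] [DecidableEq D] {n c : ℕ} (ψ : QuditPair D n c) :
    applyError 1 ψ = ψ := by
  ext p
  simp [applyError, Matrix.one_apply]

lemma inner_encode (f : (Fin K → D) × (Fin c → D) × Z →+ (Fin n → D))
    (hf : Function.Injective f) (φ φ' : Qudits D K) :
    inner ℂ (encode (cosetIsometry f hf) φ) (encode (cosetIsometry f hf) φ') =
      (cosetNorm D Z c : ℂ) ^ 2 * ∑ x, starRingEnd ℂ (φ x) * φ' x *
        (Fintype.card ((Fin c → D) × Z) : ℂ) := by
  have h := inner_encode_applyError_of_diagonal f hf φ φ' 1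
    (fun i j _ hij => Matrix.one_apply_ne (hf.ne hij))
  rw [applyError_one] at h
  simpa using h

/-- Errors on the qudits in `T` are detected if no nonzero word `f (x, 0, z)` is supported on
`T`, and every `f (x, 0, 0)` agrees on `T` with some `f (0, y, z)`. -/
lemma detects_of_actsOnlyOn (f : (Fin K → D) × (Fin c → D) × Z →+ (Fin n → D))
    (hf : Function.Injective f) (T : Finset (Fin n))
    (h1 : ∀ x z, (∀ i ∉ T, f (x, 0, z) i = 0) → x = 0 ∧ z = 0)
    (h2 : ∀ x, ∃ w, ∀ i ∈ T, f (x, w) i = 0)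
    (E : Matrix (Fin n → D) (Fin n → D) ℂ) (hE : ActsOnlyOn T E) :
    Detects (LinearMap.range (encode (cosetIsometry f hf))) E := by
  obtain ⟨M, hM⟩ := hE
  -- With `y` equal, the two words differ by `f (x - x', 0, z - z')`, and a nonzero entry of `E`
  -- would force this to vanish off `T`.
  have hdiag : ∀ i j : (Fin K → D) × (Fin c → D) × Z,
      i.2.1 = j.2.1 → i ≠ j → E (f i) (f j) = 0 := by
    rintro ⟨x, y, z⟩ ⟨x', y', z'⟩ (rfl : y = y') hij
    rw [hM, if_neg]
    intro h
    obtain ⟨hx, hz⟩ := h1 (x - x') (z - z') fun i hi => by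
      have : ((x - x', 0, z - z') : (Fin K → D) × (Fin c → D) × Z) =
        (x, y, z) - (x', y, z') := by simp
      rw [this, map_sub, Pi.sub_apply, h i hi, sub_self]
    exact hij (by rw [sub_eq_zero.1 hx, sub_eq_zero.1 hz])
  -- Translating the summation variable by `w₀` turns `f (x, ·)` into `f (0, ·)` on `T`, and a
  -- diagonal entry of `E` depends only on the restriction to `T`.
  have hconst : ∀ x, ∑ w, E (f (x, w)) (f (x, w)) = ∑ w, E (f (0, w)) (f (0, w)) := by
    intro x
    obtain ⟨w₀, hw₀⟩ := h2 x
    rw [← Equiv.sum_comp (Equiv.addRight w₀)]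
    refine Finset.sum_congr rfl fun w _ => ?_
    have hr : (fun i : T => f (x, w + w₀) i) = fun i : T => f (0, w) i := by
      ext i
      have : ((x, w + w₀) : (Fin K → D) × (Fin c → D) × Z) = (0, w) + (x, w₀) := by simp
      rw [this, map_add, Pi.add_apply, hw₀ i i.2, add_zero]
    rw [hM, hM, if_pos fun _ _ => rfl, if_pos fun _ _ => rfl, Equiv.coe_addRight, hr]
  refine ⟨(∑ w, E (f (0, w)) (f (0, w))) / Fintype.card ((Fin c → D) × Z), ?_⟩
  rintro _ ⟨φ, rfl⟩ _ ⟨φ', rfl⟩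
  rw [inner_encode_applyError_of_diagonal f hf φ φ' E hdiag, inner_encode]
  have hcard : (Fintype.card ((Fin c → D) × Z) : ℂ) ≠ 0 :=
    Nat.cast_ne_zero.2 Fintype.card_ne_zero
  simp only [hconst, ← Finset.sum_mul]
  field_simp

/-- The shift by a word `f (x, 0, z)` with `x ≠ 0` is a logical operator, hence undetected. -/
lemma exists_not_detects (f : (Fin K → D) × (Fin c → D) × Z →+ (Fin n → D))
    (hf : Function.Injective f) (T : Finset (Fin n)) (x : Fin K → D) (z : Z) (hx : x ≠ 0)
    (hT : ∀ i ∉ T, f (x, 0, z) i = 0) :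
    ∃ E : Matrix (Fin n → D) (Fin n → D) ℂ, ActsOnlyOn T E ∧
      ¬ Detects (LinearMap.range (encode (cosetIsometry f hf))) E := by
  refine ⟨Matrix.of fun a a' => if a = a' + f (x, 0, z) then 1 else 0,
    ⟨Matrix.of fun u u' => if ∀ i : T, u i = u' i + f (x, 0, z) i then 1 else 0, fun a a' => ?_⟩, ?_⟩
  · simp only [Matrix.of_apply]
    rw [← ite_and]
    refine if_congr ?_ rfl rfl
    rw [funext_iff]
    constructor
    · intro h
      exact ⟨fun i hi => by rw [h, Pi.add_apply, hT i hi, add_zero], fun i => h i⟩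
    · rintro ⟨h, h'⟩ i
      by_cases hi : i ∈ T
      · exact h' ⟨i, hi⟩
      · rw [h i hi, Pi.add_apply, hT i hi, add_zero]
  · rintro ⟨t, ht⟩
    -- The encodings of `|x⟩` and `|0⟩` are orthogonal, so detection would make this matrix element
    -- zero; up to normalization it counts the pairs `(y, z)`.
    have h := ht _ ⟨EuclideanSpace.single x 1, rfl⟩ _ ⟨EuclideanSpace.single 0 1, rfl⟩
    have hcard : (Fintype.card ((Fin c → D) × Z) : ℂ) ≠ 0 :=
      Nat.cast_ne_zero.2 Fintype.card_ne_zero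
    have hnorm : (cosetNorm D Z c : ℂ) ≠ 0 := by
      have hD : (0 : ℝ) < Fintype.card D := Nat.cast_pos.2 Fintype.card_pos
      have hZ : (0 : ℝ) < Fintype.card Z := Nat.cast_pos.2 Fintype.card_pos
      unfold cosetNorm
      exact Complex.ofReal_ne_zero.2 (by positivity)
    rw [inner_encode, inner_encode_applyError] at h
    have hzero : ∑ x', starRingEnd ℂ ((EuclideanSpace.single x 1 : Qudits D K) x') *
        (EuclideanSpace.single 0 1 : Qudits D K) x' *
          (Fintype.card ((Fin c → D) × Z) : ℂ) = 0 := by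
      refine Finset.sum_eq_zero fun x' _ => ?_
      by_cases hx' : x' = x
      · simp [hx', hx]
      · simp [hx']
    rw [hzero, mul_zero, mul_zero, mul_eq_zero, or_iff_right (pow_ne_zero 2 hnorm)] at h
    have hsum (i : (Fin K → D) × (Fin c → D) × Z) :
        ∑ j : (Fin K → D) × (Fin c → D) × Z,
          starRingEnd ℂ ((EuclideanSpace.single x 1 : Qudits D K) i.1) *
          ((if i.2.1 = j.2.1 then (if f i = f j + f (x, 0, z) then 1 else 0) else 0) *
            (EuclideanSpace.single 0 1 : Qudits D K) j.1) = if i.1 = x then 1 else 0 := by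
      -- By injectivity, the only word that the shift sends to `f i` has index `i - (x, 0, z)`.
      rw [Finset.sum_eq_single (i - (x, 0, z))]
      · by_cases hi : i.1 = x <;> simp [hi]
      · intro j _ hj
        have : f i ≠ f j + f (x, 0, z) := by
          rw [← map_add]
          exact fun h => hj (eq_sub_of_add_eq (hf h).symm)
        simp [this]
      · simp
    simp only [Matrix.of_apply, hsum] at h
    refine hcard (Eq.trans ?_ h)
    rw [Fintype.sum_prod_type, Finset.sum_eq_single x]
    · simp
    · intro x' _ hx'
      simp [hx']
    · simp

end Encoder

/-! ### Polynomial codes -/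

section Poly

variable {F : Type*} [Field F]

lemma exists_ofFn_add_X_pow_mul [DecidableEq F] {l m : ℕ} {p : F[X]}
    (hp : p.degree < ((l + m : ℕ) : WithBot ℕ)) :
    ∃ u v, p = ofFn l u + X ^ l * ofFn m v := by
  refine ⟨fun i => p.coeff i, fun j => p.coeff (l + j), ?_⟩
  ext e
  rw [coeff_add, coeff_X_pow_mul']
  by_cases h : e < l
  · rw [ofFn_coeff_eq_val_of_lt _ h, if_neg (by omega), add_zero]
  · rw [ofFn_coeff_eq_zero_of_ge _ (by omega), if_pos (by omega), zero_add]
    by_cases h' : e - l < m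
    · rw [ofFn_coeff_eq_val_of_lt _ h']
      congr 1
      simp only
      omega
    · rw [ofFn_coeff_eq_zero_of_ge _ (by omega)]
      exact coeff_eq_zero_of_degree_lt (hp.trans_le (by norm_cast; omega))

lemma ofFn_add_X_pow_mul_eq_zero [DecidableEq F] {l : ℕ} {u : Fin l → F} {r : F[X]}
    (h : ofFn l u + X ^ l * r = 0) : u = 0 ∧ r = 0 := by
  have hu : u = 0 := by
    ext i
    have := congrArg (fun p : F[X] => p.coeff i) h
    simpa [coeff_X_pow_mul', ofFn_coeff_eq_val_of_lt, Nat.not_le.2 i.2] using this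
  subst hu
  simpa using h

lemma degree_ofFn_add_X_pow_mul_lt [DecidableEq F] {l m : ℕ} (u : Fin l → F) {r : F[X]}
    (hr : r.degree < m) : (ofFn l u + X ^ l * r).degree < ((l + m : ℕ) : WithBot ℕ) := by
  rw [degree_lt_iff_coeff_zero] at hr ⊢
  intro e he
  rw [coeff_add, coeff_X_pow_mul', ofFn_coeff_eq_zero_of_ge _ (by omega), if_pos (by omega),
    hr _ (by omega), zero_add]

lemma ofFn_eq_zero [DecidableEq F] {m : ℕ} {u : Fin m → F} (h : ofFn m u = 0) : u = 0 := by
  ext i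
  simpa [ofFn_coeff_eq_val_of_lt] using congrArg (fun p : F[X] => p.coeff i) h

/-- The values at the points `a i` of the polynomial of degree less than `K + s + c` whose
coefficient vector consists of the blocks `x`, `z` and `y`. -/
noncomputable def blockEval [DecidableEq F] {n : ℕ} (a : Fin n → F) (K c s : ℕ) :
    (Fin K → F) × (Fin c → F) × (Fin s → F) →+ (Fin n → F) where
  toFun w i := (ofFn K w.1 + X ^ K * (ofFn s w.2.2 + X ^ s * ofFn c w.2.1)).eval (a i)
  map_zero' := by ext; simp
  map_add' w w' := by
    ext i
    simp only [Prod.fst_add, Prod.snd_add, map_add, Pi.add_apply, eval_add, eval_mul]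
    ring

lemma exists_isQUENTACode [Fintype F] [DecidableEq F] {n K c s : ℕ} (a : Fin n → F)
    (ha : Function.Injective a) (ha0 : ∀ i, a i ≠ 0) (hK : 0 < K) (hn : n = K + s + (s + c)) :
    ∃ Q : Submodule ℂ (QuditPair F n c), IsQUENTACode n K (s + c + 1) c Q := by
  have hdeg (x : Fin K → F) (y : Fin c → F) (z : Fin s → F) :
      (ofFn K x + X ^ K * (ofFn s z + X ^ s * ofFn c y)).degree < ((K + (s + c) : ℕ) : WithBot ℕ) :=
    degree_ofFn_add_X_pow_mul_lt _ (degree_ofFn_add_X_pow_mul_lt _ (ofFn_degree_lt _))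
  have hf : Function.Injective (blockEval a K c s) := by
    rw [injective_iff_map_eq_zero]
    rintro ⟨x, y, z⟩ h
    have hp := eq_zero_of_degree_lt_of_eval_index_eq_zero (v := a) Finset.univ
      ha.injOn ((hdeg x y z).trans_le (by rw [Finset.card_univ, Fintype.card_fin]; norm_cast; omega))
      fun i _ => congrFun h i
    obtain ⟨hx, hp⟩ := ofFn_add_X_pow_mul_eq_zero hp
    obtain ⟨hz, hp⟩ := ofFn_add_X_pow_mul_eq_zero hp
    rw [hx, hz, ofFn_eq_zero hp]
    rfl
  refine ⟨_, ⟨cosetIsometry _ hf, rfl⟩, fun T hT => detects_of_actsOnlyOn _ hf T ?_ ?_, ?_⟩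
  -- Degree below `K + s`, but at least `n - (s + c) = K + s` zeros off `T`.
  · intro x z h
    have hd : (ofFn K x + X ^ K * ofFn s z).degree < ((K + s : ℕ) : WithBot ℕ) :=
      degree_ofFn_add_X_pow_mul_lt _ (ofFn_degree_lt _)
    have hp := eq_zero_of_degree_lt_of_eval_index_eq_zero (v := a) Tᶜ
      ha.injOn (hd.trans_le (by rw [Finset.card_compl, Fintype.card_fin]; norm_cast; omega))
      fun i hi => by
        simpa [blockEval] using h i (Finset.mem_compl.1 hi)
    obtain ⟨hx, hp⟩ := ofFn_add_X_pow_mul_eq_zero hp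
    exact ⟨hx, ofFn_eq_zero hp⟩
  -- Interpolation with `|T| ≤ s + c` nodes yields `r` with `r (a i) = -x (a i) / a i ^ K`, so that
  -- `x + X ^ K * r` vanishes on `T`; the points must be nonzero.
  · intro x
    have hd := Lagrange.degree_interpolate_lt (s := T) (v := a)
      (fun i => -(ofFn K x).eval (a i) / a i ^ K) ha.injOn
    obtain ⟨z, y, hzy⟩ := exists_ofFn_add_X_pow_mul (l := s) (m := c)
      (hd.trans_le (by norm_cast; omega))
    refine ⟨(y, z), fun i hi => ?_⟩
    have := pow_ne_zero K (ha0 i)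
    simp only [blockEval, AddMonoidHom.coe_mk, ZeroHom.coe_mk, ← hzy]
    rw [eval_add, eval_mul, Lagrange.eval_interpolate_at_node _ ha.injOn hi, eval_pow, eval_X]
    field_simp
    ring
  -- The nodal polynomial of `Tᶜ` has degree `K + s - 1`, so it fits into the blocks `x, z` with `y
  -- = 0`.
  · obtain ⟨T, -, hT⟩ := Finset.exists_subset_card_eq (s := (Finset.univ : Finset (Fin n)))
      (n := s + c + 1) (by simp; omega)
    have hd : (Lagrange.nodal Tᶜ a).degree < ((K + s : ℕ) : WithBot ℕ) := by
      rw [Lagrange.degree_nodal, Finset.card_compl, Fintype.card_fin]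
      norm_cast
      omega
    obtain ⟨x, z, hxz⟩ := exists_ofFn_add_X_pow_mul hd
    refine ⟨T, hT, exists_not_detects _ hf T x z ?_ ?_⟩
    -- If `x = 0`, then `X ^ K` divides the nodal polynomial and `0` is one of its nodes.
    · rintro rfl
      have h := congrArg (eval 0) hxz
      rw [Lagrange.eval_nodal] at h
      simp only [zero_sub, map_zero, zero_add, eval_mul, eval_pow, eval_X, zero_pow hK.ne',
        zero_mul, Finset.prod_eq_zero_iff, neg_eq_zero] at h
      obtain ⟨i, -, hi⟩ := h
      exact ha0 i hi
    · intro i hi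
      have : eval (a i) (ofFn K x + X ^ K * ofFn s z) = 0 := by
        rw [← hxz]
        exact Lagrange.eval_nodal_at_node (Finset.mem_compl.2 hi)
      simpa [blockEval] using this

end Poly

/-! ### Specialization to powers of a primitive `n`-th root of unity -/

theorem mainTheorem8 {F : Type*} [Field F] [Fintype F] [DecidableEq F] (n k b : ℕ)
    (C : Submodule F (Fin n → F)) (hC : IsReedSolomonCode k b C)
    (hb : 0 < b) (hbk : 2 * b ≤ k + 1) (hk : 0 < k) (hkn : k < n) (hnq : n ≤ Fintype.card F)
    (hc : 2 * k + 1 ≤ n + 2 * b) :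
    ∃ Q : Submodule ℂ (QuditPair F n (n + 2 * b - 2 * k - 1)),
      IsQUENTACode n (2 * b - 1) (n - k + 1) (n + 2 * b - 2 * k - 1) Q ∧
      IsMDSParameters n (2 * b - 1) (n - k + 1) (n + 2 * b - 2 * k - 1) ∧
      (2 * b = k + 1 →
        IsMaximalEntanglement n (2 * b - 1) (n + 2 * b - 2 * k - 1)) := by
  obtain ⟨α, hα, -⟩ := hC
  have hd : n - k + 1 = (k + 1 - 2 * b) + (n + 2 * b - 2 * k - 1) + 1 := by omega
  obtain ⟨Q, hQ⟩ := exists_isQUENTACode (K := 2 * b - 1) (c := n + 2 * b - 2 * k - 1)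
    (s := k + 1 - 2 * b) (fun i : Fin n => α ^ (i : ℕ))
    (fun i j h => Fin.ext (hα.pow_inj i.2 j.2 h))
    (fun i => pow_ne_zero _ (hα.ne_zero (by omega))) (by omega) (by omega)
  refine ⟨Q, hd ▸ hQ, ?_, fun h => ?_⟩
  -- The relation `n = K + 2s + c` gives `2 (s + c) = n - K + c`, and `c = n - K` when `s = 0`.
  · unfold IsMDSParameters
    omega
  · unfold IsMaximalEntanglement
    omega
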